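/- **Setting.** All distributions below are probability distributions on $[0,\infty)$; for such an $F$ let $\overline F(v)=\mathbb P_{V\sim F}(V\ge v)$ be the conversion rate at price $v$, and $\mathrm{opt}(F)=\sup_{p\ge 0}p\,\overline F(p)$. A price $r\ge 0$ is oracle-optimal for $F$ if $r\overline F(r)=\mathrm{opt}(F)$. A mechanism is a probability distribution $\Psi$ of posted prices on $[0,\infty)$; $\mathcal P$ is the set of all mechanisms. Put $$R(\Psi,F)=\frac{\int_0^\infty p\,\overline F(p)\,d\Psi(p)}{\mathrm{opt}(F)},\qquad \mathcal R(\mathcal P',\mathcal F)=\sup_{\Psi\in\mathcal P'}\inf_{F\in\mathcal F}R(\Psi,F).$$ For $\alpha\in[0,1]$, $F$ is $\alpha$-strongly regular if it has a density $f$, except for a possible atom at the maximum of its support, and $v\mapsto(1-\alpha)v-\overline F(v)/f(v)$ (with $\overline F(v)/0=\infty$) is non-decreasing on the part of $[0,\infty)$ strictly below that maximum (on all of $[0,\infty)$ if the support is unbounded). For $w>0$ and $q\in(0,1)$ let $\mathcal F_\alpha(w,\{q\})$ be the set of $\alpha$-strongly regular $F$ with $0<\mathbb E_F[v]<\infty$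 and $\overline F(w)=q$. Let $\Gamma_\alpha(v)=(1+(1-\alpha)v)^{-1/(1-\alpha)}$ if $\alpha<1$ and $\Gamma_1(v)=e^{-v}$, for $v\ge0$, with inverse $\Gamma_\alpha^{-1}$ on $(0,1]$. For $0<r<w$ let $F_{\alpha,r,w,q}$ be the distribution with $$\overline F_{\alpha,r,w,q}(v)=\begin{cases}1,& v\le r,\\ \Gamma_\alpha\!\left(\Gamma_\alpha^{-1}(q)\,\tfrac{v-r}{w-r}\right),& r<v\le w,\\ 0,& v>w,\end{cases}$$ and for $r\ge w$ the distribution with $\overline F_{\alpha,r,w,q}(v)=\Gamma_\alpha\!\left(\Gamma_\alpha^{-1}(q)\,v/w\right)$ for $0\le v\le r$ and $\overline F_{\alpha,r,w,q}(v)=0$ for $v>r$. Let $$J=\left[\frac{w}{\Gamma_\alpha^{-1}(q)+1},\,w\right)\ \cup\ \left\{r\in\mathbb R:\ w\le r\le \frac{w}{\alpha\,\Gamma_\alpha^{-1}(q)}\right\},$$ where the last bound is $+\infty$ if $\alpha=0$ (the second set is empty if $\alpha\,\Gamma_\alpha^{-1}(q)>1$). **Theorem 1 (Fundamental Reduction).**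 Let $\alpha\in[0,1]$, $w>0$ and $q\in(0,1)$. For every $r\in J$ the distribution $F_{\alpha,r,w,q}$ belongs to $\mathcal F_\alpha(w,\{q\})$ and $r$ is an oracle-optimal price for it. Moreover, for every set of mechanisms $\mathcal P'\subseteq\mathcal P$, $$\mathcal R\big(\mathcal P',\mathcal F_\alpha(w,\{q\})\big)=\mathcal R\big(\mathcal P',\{F_{\alpha,r,w,q}:r\in J\}\big).$$ -/

import Mathlib

open MeasureTheory Set
open scoped ENNReal NNReal

noncomputable section

namespace SinglePointPricing

/-! ### Distributions, mechanisms, revenue and the maximin ratio -/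

/-- Probability distributions on the line whose support is included in `[0, ∞)`. -/
def nonnegLaws : Set (Measure ℝ) :=
  {F | IsProbabilityMeasure F ∧ F (Iio 0) = 0}

/-- A (randomized) pricing mechanism is the distribution of the posted price. -/
def mechanisms : Set (Measure ℝ) := nonnegLaws

/-- The conversion rate at the price `v`: the probability that a buyer with value drawn
from `F` buys at the price `v`, i.e. that the value is at least `v`. -/
def survival (F : Measure ℝ) (v : ℝ) : ℝ≥0∞ := F (Ici v)

/-- Expected revenue of the mechanism `Ψ` when the values are drawn from `F`. -/
def revenue (Ψ F : Measure ℝ) : ℝ≥0∞ :=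
  ∫⁻ p, ENNReal.ofReal p * survival F p ∂Ψ

/-- Optimal (oracle) revenue: the best posted-price revenue with knowledge of `F`. -/
def opt (F : Measure ℝ) : ℝ≥0∞ :=
  ⨆ p ∈ Ici (0 : ℝ), ENNReal.ofReal p * survival F p

/-- `p` is an oracle-optimal price for `F`. -/
def IsOptimalPrice (F : Measure ℝ) (p : ℝ) : Prop :=
  0 ≤ p ∧ ENNReal.ofReal p * survival F p = opt F

/-- Performance ratio of `Ψ` against `F`. -/
def ratio (Ψ F : Measure ℝ) : ℝ≥0∞ := revenue Ψ F / opt F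

/-- Maximin ratio of a class of mechanisms against a class of distributions. -/
def maximinRatio (P' 𝓕 : Set (Measure ℝ)) : ℝ≥0∞ :=
  ⨆ Ψ ∈ P', ⨅ F ∈ 𝓕, ratio Ψ F

/-! ### Strongly regular distributions -/

/-- The part of the line strictly below the maximum of the support of `F`
(the whole line if the support is unbounded). -/
def belowMax (F : Measure ℝ) : Set ℝ := {v | 0 < F (Ioi v)}

/-- The `α`-virtual value `(1 - α) v - F̄(v) / f(v)`, for a density `f`. Below the maximum of
the support `F̄(v) > 0`, and the quotient is `∞` where `f(v) = 0`. -/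
def virtualValue (α : ℝ) (F : Measure ℝ) (f : ℝ → ℝ≥0) (v : ℝ) : EReal :=
  (((1 - α) * v : ℝ) : EReal) - ((survival F v / (f v : ℝ≥0∞) : ℝ≥0∞) : EReal)

/-- `F` is `α`-strongly regular: it has a density, except for a possible atom at the maximum
of its support, and its `α`-virtual value is non-decreasing. -/
def IsStronglyRegular (α : ℝ) (F : Measure ℝ) : Prop :=
  ∃ f : ℝ → ℝ≥0, Measurable f ∧
    F.restrict (belowMax F) =
      (volume.restrict (belowMax F)).withDensity (fun v => (f v : ℝ≥0∞)) ∧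
    MonotoneOn (virtualValue α F f) (Ici 0 ∩ belowMax F)

/-- The `α`-strongly regular distributions on `[0, ∞)` with finite and non-zero expectation
and conversion rate `q` at the price `w`. -/
def regularClass (α w q : ℝ) : Set (Measure ℝ) :=
  {F | F ∈ nonnegLaws ∧ 0 < ∫⁻ v, ENNReal.ofReal v ∂F ∧ ∫⁻ v, ENNReal.ofReal v ∂F < ∞ ∧
    survival F w = ENNReal.ofReal q ∧ IsStronglyRegular α F}

/-! ### Generalized Pareto survival functions -/

/-- The generalized Pareto survival function `Γ_α` (used for `v ≥ 0`). -/
def Gam (α v : ℝ) : ℝ :=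
  if α = 1 then Real.exp (-v) else (1 + (1 - α) * v) ^ (-1 / (1 - α))

/-- The inverse of `Γ_α` (used on `(0, 1]`). -/
def GamInv (α u : ℝ) : ℝ :=
  if α = 1 then -Real.log u else (u ^ (-(1 - α)) - 1) / (1 - α)

theorem GamInv_Gam {α v : ℝ} (hα : α ≤ 1) (hv : 0 ≤ v) : GamInv α (Gam α v) = v := by
  unfold GamInv Gam
  split_ifs with h
  · simp
  · have h1 : 0 < 1 - α := sub_pos.2 (lt_of_le_of_ne hα h)
    have h2 : 0 ≤ 1 + (1 - α) * v := by positivity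
    rw [← Real.rpow_mul h2]
    have h3 : -1 / (1 - α) * -(1 - α) = 1 := by field_simp
    rw [h3, Real.rpow_one]
    field_simp
    ring

theorem Gam_GamInv {α u : ℝ} (hα : α ≤ 1) (hu : 0 < u) : Gam α (GamInv α u) = u := by
  unfold GamInv Gam
  split_ifs with h
  · simp [Real.exp_log hu]
  · have h1 : 0 < 1 - α := sub_pos.2 (lt_of_le_of_ne hα h)
    have h2 : 1 + (1 - α) * ((u ^ (-(1 - α)) - 1) / (1 - α)) = u ^ (-(1 - α)) := by
      field_simp
      ring
    rw [h2, ← Real.rpow_mul hu.le]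
    have h3 : -(1 - α) * (-1 / (1 - α)) = 1 := by field_simp
    rw [h3, Real.rpow_one]

theorem Gam_pos {α v : ℝ} (hα : α ≤ 1) (hv : 0 ≤ v) : 0 < Gam α v := by
  unfold Gam
  split_ifs with h
  · exact Real.exp_pos _
  · have h1 : 0 < 1 - α := sub_pos.2 (lt_of_le_of_ne hα h)
    exact Real.rpow_pos_of_pos (by positivity) _

theorem Gam_zero (α : ℝ) : Gam α 0 = 1 := by
  unfold Gam
  split_ifs <;> simp

theorem Gam_le_of_le {α x y : ℝ} (hα : α ≤ 1) (hx : 0 ≤ x) (hxy : x ≤ y) :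
    Gam α y ≤ Gam α x := by
  unfold Gam
  split_ifs with h
  · exact Real.exp_le_exp.2 (by linarith)
  · have h1 : 0 < 1 - α := sub_pos.2 (lt_of_le_of_ne hα h)
    refine Real.rpow_le_rpow_of_nonpos (by positivity) (by gcongr) ?_
    exact div_nonpos_of_nonpos_of_nonneg (by norm_num) h1.le

theorem Gam_le_one {α v : ℝ} (hα : α ≤ 1) (hv : 0 ≤ v) : Gam α v ≤ 1 :=
  (Gam_le_of_le hα le_rfl hv).trans_eq (Gam_zero α)

theorem GamInv_nonneg {α u : ℝ} (hα : α ≤ 1) (hu : 0 < u) (hu1 : u ≤ 1) : 0 ≤ GamInv α u := by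
  unfold GamInv
  split_ifs with h
  · linarith [Real.log_nonpos hu.le hu1]
  · have h1 : 0 < 1 - α := sub_pos.2 (lt_of_le_of_ne hα h)
    have := Real.one_le_rpow_of_pos_of_le_one_of_nonpos hu hu1 (z := -(1 - α)) (by linarith)
    exact div_nonneg (by linarith) h1.le

theorem GamInv_pos {α u : ℝ} (hα : α ≤ 1) (hu : 0 < u) (hu1 : u < 1) : 0 < GamInv α u := by
  refine lt_of_le_of_ne (GamInv_nonneg hα hu hu1.le) fun h => ?_
  have := Gam_GamInv hα hu
  rw [← h, Gam_zero] at this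
  linarith

theorem le_GamInv_iff {α u x : ℝ} (hα : α ≤ 1) (hx : 0 ≤ x) (hu : 0 < u) (hu1 : u ≤ 1) :
    x ≤ GamInv α u ↔ u ≤ Gam α x := by
  constructor
  · intro h
    calc u = Gam α (GamInv α u) := (Gam_GamInv hα hu).symm
      _ ≤ Gam α x := Gam_le_of_le hα hx h
  · intro h
    by_contra! hlt
    have h1 := Gam_le_of_le hα (GamInv_nonneg hα hu hu1) hlt.le
    rw [Gam_GamInv hα hu] at h1
    have h2 : GamInv α u = x := by rw [le_antisymm h h1, GamInv_Gam hα hx]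
    linarith

theorem measurable_GamInv (α : ℝ) : Measurable (GamInv α) := by
  unfold GamInv
  split_ifs
  · fun_prop
  · fun_prop

/-- The generalized Pareto survival function through `(a, qa)` and `(b, qb)`. -/
def Hbar (α a qa b qb v : ℝ) : ℝ :=
  qa * Gam α (GamInv α (qb / qa) * ((v - a) / (b - a)))

/-! ### The one-parameter family -/

/-- Survival function of the candidate worst case with parameter `r`. If `r < w`, it equals `1`
up to `r` and is then generalized Pareto from `(r, 1)` to `(w, q)`, with an atom at `w`; if
`r ≥ w`, it is generalized Pareto from `(0, 1)` through `(w, q)`, truncated at `r`, with an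
atom at `r`. -/
def worstSurvival (α r w q v : ℝ) : ℝ :=
  if r < w then
    if v ≤ r then 1 else if v ≤ w then Hbar α r 1 w q v else 0
  else
    if v ≤ 0 then 1 else if v ≤ r then Hbar α 0 1 w q v else 0

/-- The distribution with survival function `worstSurvival α r w q`, built by applying the
quantile transform to a uniform variable on `(0, 1]`. -/
def worstLaw (α r w q : ℝ) : Measure ℝ :=
  Measure.map
    (fun u =>
      if r < w then min w (r + (w - r) * (GamInv α u / GamInv α q))
      else min r (w * (GamInv α u / GamInv α q)))
    (volume.restrict (Ioc (0 : ℝ) 1))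

theorem measurable_quantile (α r w q : ℝ) : Measurable (fun u =>
      if r < w then min w (r + (w - r) * (GamInv α u / GamInv α q))
      else min r (w * (GamInv α u / GamInv α q))) := by
  have := measurable_GamInv α
  split_ifs <;> fun_prop

theorem survival_gpd_aux {α q a d m v : ℝ} (hα : α ≤ 1) (hq : 0 < q) (hq1 : q < 1)
    (hd : 0 < d) (ham : a ≤ m) :
    volume ({u | v ≤ min m (a + d * (GamInv α u / GamInv α q))} ∩ Ioc (0 : ℝ) 1) =
      ENNReal.ofReal (if v ≤ a then 1 else if v ≤ m then
        Gam α (GamInv α q * ((v - a) / d)) else 0) := by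
  have hb := GamInv_pos hα hq hq1
  split_ifs with h1 h2
  · have : {u | v ≤ min m (a + d * (GamInv α u / GamInv α q))} ∩ Ioc (0 : ℝ) 1 = Ioc 0 1 := by
      refine inter_eq_right.2 fun u hu => ?_
      have h0 := GamInv_nonneg hα hu.1 hu.2
      have : 0 ≤ d * (GamInv α u / GamInv α q) := by positivity
      exact le_min (h1.trans ham) (by linarith)
    rw [this, Real.volume_Ioc]
    simp
  · push Not at h1
    have hx : 0 ≤ GamInv α q * ((v - a) / d) :=
      mul_nonneg hb.le (div_nonneg (by linarith) hd.le)
    have : {u | v ≤ min m (a + d * (GamInv α u / GamInv α q))} ∩ Ioc (0 : ℝ) 1 =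
        Ioc 0 (Gam α (GamInv α q * ((v - a) / d))) := by
      ext u
      simp only [mem_inter_iff, mem_ofPred_eq, mem_Ioc, le_min_iff]
      have key : v ≤ a + d * (GamInv α u / GamInv α q) ↔
          GamInv α q * ((v - a) / d) ≤ GamInv α u := by
        rw [← sub_le_iff_le_add', ← div_le_iff₀' hd, le_div_iff₀' hb]
      constructor
      · rintro ⟨⟨_, h3⟩, h4, h5⟩
        exact ⟨h4, (le_GamInv_iff hα hx h4 h5).1 (key.1 h3)⟩
      · rintro ⟨h4, h5⟩
        have h6 := h5.trans (Gam_le_one hα hx)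
        exact ⟨⟨h2, key.2 ((le_GamInv_iff hα hx h4 h6).2 h5)⟩, h4, h6⟩
    rw [this, Real.volume_Ioc, sub_zero]
  · have : {u | v ≤ min m (a + d * (GamInv α u / GamInv α q))} ∩ Ioc (0 : ℝ) 1 = ∅ := by
      ext u
      simp only [mem_inter_iff, mem_ofPred_eq, le_min_iff, mem_empty_iff_false]
      tauto
    rw [this]
    simp

/-- `worstLaw` is the distribution with survival function `worstSurvival`. -/
theorem survival_worstLaw {α r w q : ℝ} (hα : α ≤ 1) (hq : 0 < q) (hq1 : q < 1) (hw : 0 < w)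
    (v : ℝ) :
    survival (worstLaw α r w q) v = ENNReal.ofReal (worstSurvival α r w q v) := by
  unfold survival worstLaw
  rw [Measure.map_apply (measurable_quantile α r w q) measurableSet_Ici,
    Measure.restrict_apply ((measurable_quantile α r w q) measurableSet_Ici)]
  unfold worstSurvival Hbar
  by_cases h : r < w
  · simp only [h, if_true, one_mul, div_one]
    exact survival_gpd_aux hα hq hq1 (sub_pos.2 h) h.le
  · simp only [h, if_false, one_mul, div_one, sub_zero]
    have := survival_gpd_aux (v := v) (m := r) hα hq hq1 hw (a := 0) (by linarith)
    simp only [zero_add, sub_zero] at this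
    exact this

/-- The range of the parameter: from `w / (Γ_α⁻¹(q) + 1)` up to `w` (translated generalized
Pareto laws), and from `w` up to `w / (α Γ_α⁻¹(q))` (truncated ones), the last bound being `∞`
if `α = 0`. -/
def priceRange (α w q : ℝ) : Set ℝ :=
  Ico (w / (GamInv α q + 1)) w ∪ {r | w ≤ r ∧ (α = 0 ∨ r ≤ w / (α * GamInv α q))}

/-- The one-parameter family of candidate worst cases. -/
def worstFamily (α w q : ℝ) : Set (Measure ℝ) :=
  (fun r => worstLaw α r w q) '' priceRange α w q

end SinglePointPricing

end

noncomputable section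

namespace SinglePointPricing

/-! ### Calculus of the generalized Pareto survival function -/

/-! The key is that monotonicity of the `α`-virtual value makes `Γ_α⁻¹ ∘ F̄` convex below the
maximum of the support. At a price `p` with positive density, take the line tangent to `Γ_α⁻¹ ∘ F̄`.
Its image under `Γ_α` is a Pareto curve with the same value and hazard rate as `F̄` at `p`, and
comparing hazard rates on both sides of `p` keeps `F̄` above it
(`IsStronglyRegular.exists_supporting_line`, in chord form `IsStronglyRegular.convex_chord`).

Given `F` in the class, finiteness of the mean provides an oracle-optimal price `r`
(`exists_maximal_revenue`). Write `S` for the survival function of the family member with this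
parameter. Convexity, together with `F̄(0) = 1` and `F̄(w) = q`, gives `S(p) / S(r) ≤ F̄(p) / F̄(r)`
for every `p ≥ 0` (`worstSurvival_mul_surv_le`). If `r` is optimal for both laws, multiplying by `p
/ r` compares the normalized revenues price by price, hence the ratios of every mechanism at once.

It remains that `r` lies in the prescribed range and that `r` is optimal for `S`. The first follows
from one-sided first-order conditions at `r`, where `F̄` is replaced by its Pareto minorant
(`maximal_price_mem_priceRange`); the second is a direct computation under the same bounds
(`worst_revenue_le`). As the family is contained in the class, the infima agree for each mechanism
separately, whatever the set of mechanisms. -/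

theorem Gam_pos_of_base_pos {α x : ℝ} (hx : 0 < 1 + (1 - α) * x) : 0 < Gam α x := by
  unfold Gam
  split_ifs with h
  · exact Real.exp_pos _
  · exact Real.rpow_pos_of_pos hx _

theorem base_pos {α x : ℝ} (hα : α ≤ 1) (hx : 0 ≤ x) : 0 < 1 + (1 - α) * x := by
  have := mul_nonneg (sub_nonneg.2 hα) hx
  linarith

/-- Both branches of `Γ_α` solve the same linear differential equation, so the monotonicity
arguments below treat `α = 1` and `α < 1` together. -/
theorem hasDerivAt_Gam {α x : ℝ} (hx : 0 < 1 + (1 - α) * x) :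
    HasDerivAt (Gam α) (-(Gam α x / (1 + (1 - α) * x))) x := by
  unfold Gam
  split_ifs with h
  · subst h
    simpa using (hasDerivAt_neg x).exp
  · have h1 : 1 - α ≠ 0 := sub_ne_zero.2 (Ne.symm h)
    have h2 : HasDerivAt (fun v : ℝ => 1 + (1 - α) * v) (1 - α) x := by
      simpa using ((hasDerivAt_id x).const_mul (1 - α)).const_add 1
    have h3 := h2.rpow_const (p := -1 / (1 - α)) (Or.inl hx.ne')
    convert h3 using 1
    rw [Real.rpow_sub_one hx.ne']
    generalize 1 + (1 - α) * x = d
    field_simp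

theorem contDiffAt_Gam {α x : ℝ} (hx : 0 < 1 + (1 - α) * x) : ContDiffAt ℝ 1 (Gam α) x := by
  unfold Gam
  split_ifs with h
  · fun_prop
  · exact ContDiffAt.rpow_const_of_ne (by fun_prop) hx.ne'

theorem hasDerivAt_inv_Gam {α x : ℝ} (hx : 0 < 1 + (1 - α) * x) :
    HasDerivAt (fun v => (Gam α v)⁻¹) ((Gam α x)⁻¹ / (1 + (1 - α) * x)) x := by
  have h0 := (Gam_pos_of_base_pos hx).ne'
  have h : HasDerivAt (fun v => (Gam α v)⁻¹)
      (- -(Gam α x / (1 + (1 - α) * x)) / Gam α x ^ 2) x := (hasDerivAt_Gam hx).inv h0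
  have h1 : - -(Gam α x / (1 + (1 - α) * x)) / Gam α x ^ 2 =
      (Gam α x)⁻¹ / (1 + (1 - α) * x) := by
    generalize 1 + (1 - α) * x = d
    field_simp
  rwa [h1] at h

/-- The derivative of `z Γ_α(z)` has the sign of `1 - α z`. This is the source of the upper end `w /
(α Γ_α⁻¹(q))` of the price range. -/
theorem mul_Gam_le_mul_Gam {α x y : ℝ} (hα0 : 0 ≤ α) (hα : α ≤ 1) (hx : 0 ≤ x) (hxy : x ≤ y)
    (hy : α * y ≤ 1) : x * Gam α x ≤ y * Gam α y := by
  have hd : ∀ z ∈ Icc 0 y, HasDerivAt (fun v => v * Gam α v)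
      (1 * Gam α z + z * -(Gam α z / (1 + (1 - α) * z))) z := fun z hz =>
    (hasDerivAt_id z).mul (hasDerivAt_Gam (base_pos hα hz.1))
  have : MonotoneOn (fun v => v * Gam α v) (Icc 0 y) := by
    refine monotoneOn_of_deriv_nonneg (convex_Icc 0 y)
      (fun z hz => (hd z hz).continuousAt.continuousWithinAt)
      (fun z hz => (hd z (interior_subset hz)).differentiableAt.differentiableWithinAt) ?_
    intro z hz
    replace hz := interior_subset hz
    rw [(hd z hz).deriv]
    have h1 := base_pos hα hz.1
    have h2 := Gam_pos hα hz.1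
    have h3 : α * z ≤ 1 := (mul_le_mul_of_nonneg_left hz.2 hα0).trans hy
    have h4 : 1 * Gam α z + z * -(Gam α z / (1 + (1 - α) * z)) =
        Gam α z * (1 - α * z) / (1 + (1 - α) * z) := by
      obtain ⟨d, hd⟩ : ∃ d, d = 1 + (1 - α) * z := ⟨_, rfl⟩
      rw [← hd] at h1 ⊢
      field_simp
      rw [hd]
      ring
    rw [h4]
    exact div_nonneg (mul_nonneg h2.le (by linarith)) h1.le
  exact this ⟨hx, hxy⟩ ⟨hx.trans hxy, le_rfl⟩ hxy

/-- The product is `1` at `0` and its derivative has the sign of `-α z`. It serves to show that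
revenue does not exceed `r` beyond `r` when `r < w`. -/
theorem one_add_mul_Gam_le_one {α x : ℝ} (hα0 : 0 ≤ α) (hα : α ≤ 1) (hx : 0 ≤ x) :
    (1 + x) * Gam α x ≤ 1 := by
  have hd : ∀ z ∈ Ici (0 : ℝ), HasDerivAt (fun v => (1 + v) * Gam α v)
      (1 * Gam α z + (1 + z) * -(Gam α z / (1 + (1 - α) * z))) z := fun z hz =>
    ((hasDerivAt_id z).const_add 1).mul (hasDerivAt_Gam (base_pos hα hz))
  have : AntitoneOn (fun v => (1 + v) * Gam α v) (Ici 0) := by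
    refine antitoneOn_of_deriv_nonpos (convex_Ici 0)
      (fun z hz => (hd z hz).continuousAt.continuousWithinAt)
      (fun z hz => (hd z (interior_subset hz)).differentiableAt.differentiableWithinAt) ?_
    intro z hz
    replace hz : 0 ≤ z := interior_subset hz
    rw [(hd z hz).deriv]
    have h1 := base_pos hα hz
    have h2 := Gam_pos hα hz
    have h4 : 1 * Gam α z + (1 + z) * -(Gam α z / (1 + (1 - α) * z)) =
        -(Gam α z * (α * z) / (1 + (1 - α) * z)) := by
      obtain ⟨d, hd⟩ : ∃ d, d = 1 + (1 - α) * z := ⟨_, rfl⟩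
      rw [← hd] at h1 ⊢
      field_simp
      rw [hd]
      ring
    rw [h4]
    exact neg_nonpos.2 (div_nonneg (mul_nonneg h2.le (mul_nonneg hα0 hz)) h1.le)
  simpa [Gam_zero] using this self_mem_Ici hx hx

/-- For `t ≤ 1`, the ratio `Γ_α (t x) / Γ_α x` is non-decreasing in `x`. -/
theorem Gam_mul_Gam_le {α t x y : ℝ} (hα : α ≤ 1) (ht0 : 0 ≤ t) (ht : t ≤ 1) (hx : 0 ≤ x)
    (hxy : x ≤ y) : Gam α (t * x) * Gam α y ≤ Gam α (t * y) * Gam α x := by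
  have hd : ∀ z ∈ Ici (0 : ℝ), HasDerivAt (fun v => Gam α (t * v) * (Gam α v)⁻¹)
      (-(Gam α (t * z) / (1 + (1 - α) * (t * z))) * t * (Gam α z)⁻¹ +
        Gam α (t * z) * ((Gam α z)⁻¹ / (1 + (1 - α) * z))) z := by
    intro z hz
    have h1 : HasDerivAt (fun v : ℝ => t * v) t z := by
      simpa using (hasDerivAt_id z).const_mul t
    exact ((hasDerivAt_Gam (base_pos hα (mul_nonneg ht0 hz))).comp z h1).mul
      (hasDerivAt_inv_Gam (base_pos hα hz))
  have : MonotoneOn (fun v => Gam α (t * v) * (Gam α v)⁻¹) (Ici 0) := by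
    refine monotoneOn_of_deriv_nonneg (convex_Ici 0)
      (fun z hz => (hd z hz).continuousAt.continuousWithinAt)
      (fun z hz => (hd z (interior_subset hz)).differentiableAt.differentiableWithinAt) ?_
    intro z hz
    replace hz : 0 ≤ z := interior_subset hz
    rw [(hd z hz).deriv]
    have h1 := base_pos hα hz
    have h2 := Gam_pos hα hz
    have h3 := base_pos hα (mul_nonneg ht0 hz)
    have h4 := Gam_pos hα (mul_nonneg ht0 hz)
    have h5 : -(Gam α (t * z) / (1 + (1 - α) * (t * z))) * t * (Gam α z)⁻¹ +
        Gam α (t * z) * ((Gam α z)⁻¹ / (1 + (1 - α) * z)) =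
        Gam α (t * z) * (1 - t) / (Gam α z * (1 + (1 - α) * (t * z)) * (1 + (1 - α) * z)) := by
      obtain ⟨d, hd⟩ : ∃ d, d = 1 + (1 - α) * z := ⟨_, rfl⟩
      obtain ⟨e, he⟩ : ∃ e, e = 1 + (1 - α) * (t * z) := ⟨_, rfl⟩
      rw [← hd] at h1 ⊢
      rw [← he] at h3 ⊢
      field_simp
      rw [hd, he]
      ring
    rw [h5]
    exact div_nonneg (mul_nonneg h4.le (by linarith)) (by positivity)
  have h := this (show x ∈ Ici (0 : ℝ) from hx) (show y ∈ Ici (0 : ℝ) from hx.trans hxy) hxy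
  simp only [← div_eq_mul_inv] at h
  rwa [div_le_div_iff₀ (Gam_pos hα hx) (Gam_pos hα (hx.trans hxy))] at h

/-- Conditioning on `v ≥ r` divides the survival function by a constant, which acts on its
`Γ_α⁻¹`-transform as an affine map of positive slope. Chord inequalities therefore survive
conditioning. -/
theorem GamInv_div {α u c : ℝ} (hα : α ≤ 1) (hu : 0 < u) (hc : 0 < c) :
    GamInv α (u / c) = c ^ (1 - α) * (GamInv α u - GamInv α c) := by
  unfold GamInv
  split_ifs with h
  · subst h
    rw [Real.log_div hu.ne' hc.ne', sub_self, Real.rpow_zero]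
    ring
  · have h1 : 1 - α ≠ 0 := sub_ne_zero.2 (Ne.symm h)
    rw [Real.div_rpow hu.le hc.le, Real.rpow_neg hc.le]
    have := (Real.rpow_pos_of_pos hc (1 - α)).ne'
    field_simp
    ring

theorem GamInv_le_of_le {α x y : ℝ} (hα : α ≤ 1) (hx : 0 < x) (hxy : x ≤ y) :
    GamInv α y ≤ GamInv α x := by
  unfold GamInv
  split_ifs with h
  · exact neg_le_neg (Real.log_le_log hx hxy)
  · have h1 : 0 < 1 - α := sub_pos.2 (lt_of_le_of_ne hα h)
    have := Real.rpow_le_rpow_of_nonpos hx hxy (neg_nonpos.2 h1.le)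
    gcongr

theorem GamInv_one (α : ℝ) : GamInv α 1 = 0 := by
  unfold GamInv
  split_ifs <;> simp

/-! ### Truncated generalized Pareto laws -/

theorem survival_anti (F : Measure ℝ) : Antitone (survival F) := fun _ _ h =>
  measure_mono (Ici_subset_Ici.2 h)

theorem measure_Ioi_eq_zero_of_survival {F : Measure ℝ} {m : ℝ}
    (h : ∀ v, m < v → survival F v = 0) : F (Ioi m) = 0 := by
  obtain ⟨u, -, hu, hlim⟩ := exists_seq_strictAnti_tendsto m
  rw [← iUnion_Ici_eq_Ioi_of_lt_of_tendsto hu hlim]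
  exact measure_iUnion_null fun n => h _ (hu n)

/-- The survival function equal to `1` up to `a`, generalized Pareto with slope `b / d` from `a`
to `m`, and zero beyond `m`. -/
def paretoSurvival (α b a d m v : ℝ) : ℝ :=
  if v ≤ a then 1 else if v ≤ m then Gam α (b * ((v - a) / d)) else 0

/-- The density of the law with survival function `paretoSurvival`, below its atom. -/
def paretoDensity (α b a d v : ℝ) : ℝ :=
  Gam α (b * ((v - a) / d)) / (1 + (1 - α) * (b * ((v - a) / d))) * (b / d)

theorem paretoArg_nonneg {b a d v : ℝ} (hb : 0 < b) (hd : 0 < d) (hv : a ≤ v) :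
    0 ≤ b * ((v - a) / d) :=
  mul_nonneg hb.le (div_nonneg (sub_nonneg.2 hv) hd.le)

theorem paretoDensity_pos {α b a d v : ℝ} (hα : α ≤ 1) (hb : 0 < b) (hd : 0 < d) (hv : a ≤ v) :
    0 < paretoDensity α b a d v := by
  have h := paretoArg_nonneg hb hd hv
  exact mul_pos (div_pos (Gam_pos hα h) (base_pos hα h)) (div_pos hb hd)

theorem hasDerivAt_paretoGam {α b a d v : ℝ} (hα : α ≤ 1) (hb : 0 < b) (hd : 0 < d)
    (hv : a ≤ v) :
    HasDerivAt (fun v => Gam α (b * ((v - a) / d))) (-paretoDensity α b a d v) v := by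
  have h1 : HasDerivAt (fun v : ℝ => b * ((v - a) / d)) (b * (1 / d)) v :=
    (((hasDerivAt_id v).sub_const a).div_const d).const_mul b
  have h2 := (hasDerivAt_Gam (base_pos hα (paretoArg_nonneg hb hd hv))).comp v h1
  have h3 : -(Gam α (b * ((v - a) / d)) / (1 + (1 - α) * (b * ((v - a) / d)))) * (b * (1 / d)) =
      -paretoDensity α b a d v := by
    unfold paretoDensity
    ring
  rwa [h3] at h2

theorem continuousOn_paretoDensity {α b a d : ℝ} (hα : α ≤ 1) (hb : 0 < b) (hd : 0 < d) :
    ContinuousOn (paretoDensity α b a d) (Ici a) := by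
  unfold paretoDensity
  refine ContinuousOn.mul (ContinuousOn.div (fun v hv => ?_) (by fun_prop) fun v hv => ?_)
    continuousOn_const
  · exact (hasDerivAt_paretoGam hα hb hd hv).continuousAt.continuousWithinAt
  · exact (base_pos hα (paretoArg_nonneg hb hd hv)).ne'

theorem setLIntegral_paretoDensity {α b a d m c : ℝ} (hα : α ≤ 1) (hb : 0 < b) (hd : 0 < d)
    (hc : a ≤ c) (hcm : c ≤ m) :
    ∫⁻ v in Ioc c m, ENNReal.ofReal (paretoDensity α b a d v) =
      ENNReal.ofReal (Gam α (b * ((c - a) / d)) - Gam α (b * ((m - a) / d))) := by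
  have hint : IntervalIntegrable (paretoDensity α b a d) volume c m := by
    refine ((continuousOn_paretoDensity hα hb hd).mono ?_).intervalIntegrable
    rw [uIcc_of_le hcm]
    exact fun v hv => hc.trans hv.1
  have h1 : ∫ v in c..m, -paretoDensity α b a d v =
      Gam α (b * ((m - a) / d)) - Gam α (b * ((c - a) / d)) := by
    refine intervalIntegral.integral_eq_sub_of_hasDerivAt (f := fun v => Gam α (b * ((v - a) / d)))
      (fun v hv => ?_) hint.neg
    rw [uIcc_of_le hcm] at hv
    exact hasDerivAt_paretoGam hα hb hd (hc.trans hv.1)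
  rw [intervalIntegral.integral_neg, intervalIntegral.integral_of_le hcm] at h1
  rw [← ofReal_integral_eq_lintegral_ofReal
    ((intervalIntegrable_iff_integrableOn_Ioc_of_le hcm).1 hint)]
  · congr 1
    linarith
  · refine (ae_restrict_iff' measurableSet_Ioc).2 (Filter.Eventually.of_forall fun v hv => ?_)
    exact (paretoDensity_pos hα hb hd (hc.trans hv.1.le)).le

theorem measurable_Gam (α : ℝ) : Measurable (Gam α) := by
  unfold Gam
  split_ifs <;> fun_prop

section

variable {F : Measure ℝ} {α b a d m : ℝ}

theorem belowMax_of_paretoSurvival (hα : α ≤ 1) (hb : 0 < b) (hd : 0 < d) (ham : a < m)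
    (hF : ∀ v, survival F v = ENNReal.ofReal (paretoSurvival α b a d m v)) :
    belowMax F = Iio m := by
  ext v
  simp only [belowMax, mem_ofPred_eq, mem_Iio]
  constructor
  · intro h
    by_contra! hv
    refine h.ne' (measure_mono_null (Ioi_subset_Ioi hv) (measure_Ioi_eq_zero_of_survival ?_))
    intro x hx
    simp [hF, paretoSurvival, (ham.trans hx).not_ge, hx.not_ge]
  · intro h
    have : 0 < survival F m := by
      rw [hF]
      simp only [paretoSurvival, ham.not_ge, if_false, le_refl, if_true]
      exact ENNReal.ofReal_pos.2 (Gam_pos hα (paretoArg_nonneg hb hd ham.le))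
    exact this.trans_le (measure_mono fun x (hx : m ≤ x) => h.trans_le hx)

/-- The virtual value is `-∞` up to `a`, where the chosen density vanishes, and constant equal to
`(1 - α) a - d / b` between `a` and `m`. -/
theorem isStronglyRegular_of_paretoSurvival [IsFiniteMeasure F] (hα : α ≤ 1) (hb : 0 < b)
    (hd : 0 < d) (ham : a < m)
    (hF : ∀ v, survival F v = ENNReal.ofReal (paretoSurvival α b a d m v)) :
    IsStronglyRegular α F := by
  have hmax := belowMax_of_paretoSurvival hα hb hd ham hF
  refine ⟨fun v => if v ≤ a then 0 else (paretoDensity α b a d v).toNNReal, ?_, ?_, ?_⟩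
  · refine Measurable.ite measurableSet_Iic measurable_const (Measurable.real_toNNReal ?_)
    have := measurable_Gam α
    unfold paretoDensity
    fun_prop
  · rw [hmax]
    refine Measure.ext_of_Ici _ _ fun v => ?_
    rw [Measure.restrict_apply measurableSet_Ici, withDensity_apply _ measurableSet_Ici,
      Measure.restrict_restrict measurableSet_Ici, Ici_inter_Iio]
    rcases le_or_gt m v with hv | hv
    · simp [Ico_eq_empty_of_le hv]
    · have h1 : F (Ico v m) = survival F v - survival F m := by
        rw [← Ici_sdiff_Ici]
        exact measure_sdiff (Ici_subset_Ici.2 hv.le) measurableSet_Ici.nullMeasurableSet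
          (measure_ne_top _ _)
      -- No mass lies below `a`, so the integral over `[v, m)` effectively starts at `max v a`.
      have hc : a ≤ max v a := le_max_right _ _
      have h2 : paretoSurvival α b a d m v = Gam α (b * ((max v a - a) / d)) := by
        unfold paretoSurvival
        split_ifs with h
        · simp [max_eq_right h, Gam_zero]
        · rw [max_eq_left (not_le.1 h).le]
        · exact absurd hv.le ‹_›
      have h3 : paretoSurvival α b a d m m = Gam α (b * ((m - a) / d)) := by
        simp [paretoSurvival, ham.not_ge]
      rw [h1, hF, hF, h2, h3,
        ← ENNReal.ofReal_sub _ (Gam_pos hα (paretoArg_nonneg hb hd ham.le)).le,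
        ← setLIntegral_paretoDensity hα hb hd hc (max_le hv.le ham.le),
        ← lintegral_inter_add_sdiff (B := Iic a) _ (Ico v m) measurableSet_Iic]
      have h4 : ∫⁻ x in Ico v m ∩ Iic a,
          ((if x ≤ a then 0 else (paretoDensity α b a d x).toNNReal : ℝ≥0) : ℝ≥0∞) = 0 := by
        rw [setLIntegral_congr_fun (g := fun _ => 0) (measurableSet_Ico.inter measurableSet_Iic)]
        · simp
        · intro x hx
          simp [show x ≤ a from hx.2]
      have h5 : (Ico v m \ Iic a : Set ℝ) =ᵐ[volume] Ioc (max v a) m := by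
        rcases le_or_gt v a with h | h
        · have : (Ico v m \ Iic a : Set ℝ) = Ioo a m := by
            ext x
            simp only [mem_sdiff, mem_Ico, mem_Iic, mem_Ioo, not_le]
            exact ⟨fun hx => ⟨hx.2, hx.1.2⟩, fun hx => ⟨⟨h.trans hx.1.le, hx.2⟩, hx.1⟩⟩
          rw [this, max_eq_right h]
          exact Ioo_ae_eq_Ioc
        · have : (Ico v m \ Iic a : Set ℝ) = Ico v m := by
            ext x
            simp only [mem_sdiff, mem_Ico, mem_Iic, not_le]
            exact ⟨fun hx => hx.1, fun hx => ⟨hx, h.trans_le hx.1⟩⟩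
          rw [this, max_eq_left h.le]
          exact Ico_ae_eq_Ioc
      rw [h4, zero_add, ← setLIntegral_congr h5]
      refine (setLIntegral_congr_fun (measurableSet_Ico.diff measurableSet_Iic) ?_).symm
      intro x hx
      have : ¬ x ≤ a := hx.2
      simp only [this, if_false]
      rfl
  · intro x hx y hy hxy
    rw [hmax] at hx hy
    have key : ∀ v, a < v → v < m → virtualValue α F
        (fun v => if v ≤ a then 0 else (paretoDensity α b a d v).toNNReal) v =
        (((1 - α) * a - d / b : ℝ) : EReal) := by
      intro v hav hvm
      have hx := paretoArg_nonneg hb hd hav.le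
      have h1 := base_pos hα hx
      have h2 := Gam_pos hα hx
      have h3 := paretoDensity_pos hα hb hd hav.le
      unfold virtualValue
      simp only [hav.not_ge, if_false, hF, paretoSurvival, hvm.le, if_true]
      rw [show ((paretoDensity α b a d v).toNNReal : ℝ≥0∞) =
        ENNReal.ofReal (paretoDensity α b a d v) from rfl, ← ENNReal.ofReal_div_of_pos h3,
        EReal.coe_ennreal_ofReal, max_eq_left (div_pos h2 h3).le, ← EReal.coe_sub]
      congr 1
      have h4 : Gam α (b * ((v - a) / d)) / paretoDensity α b a d v =
          (1 + (1 - α) * (b * ((v - a) / d))) * (d / b) := by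
        unfold paretoDensity
        rw [div_eq_iff (by positivity)]
        generalize 1 + (1 - α) * (b * ((v - a) / d)) = e at *
        field_simp
      rw [h4]
      field_simp
      ring
    rcases le_or_gt x a with hxa | hxa
    · have : virtualValue α F
          (fun v => if v ≤ a then 0 else (paretoDensity α b a d v).toNNReal) x = ⊥ := by
        unfold virtualValue
        have h0 : survival F x ≠ 0 := by
          simp [hF, paretoSurvival, hxa]
        simp [hxa, ENNReal.div_zero h0]
      rw [this]
      exact bot_le
    · rw [key x hxa hx.2, key y (hxa.trans_le hxy) hy.2]

theorem lintegral_lt_top_of_paretoSurvival [IsFiniteMeasure F] (ham : a < m)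
    (hF : ∀ v, survival F v = ENNReal.ofReal (paretoSurvival α b a d m v)) :
    ∫⁻ v, ENNReal.ofReal v ∂F < ∞ := by
  have h1 : F (Ioi m) = 0 := by
    refine measure_Ioi_eq_zero_of_survival fun x hx => ?_
    simp [hF, paretoSurvival, (ham.trans hx).not_ge, hx.not_ge]
  have h2 : ∀ᵐ v ∂F, ENNReal.ofReal v ≤ ENNReal.ofReal m := by
    rw [ae_iff]
    refine measure_mono_null (fun x hx => ?_) h1
    by_contra h
    exact hx (ENNReal.ofReal_le_ofReal (not_lt.1 h))
  refine (lintegral_mono_ae h2).trans_lt ?_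
  rw [lintegral_const]
  exact ENNReal.mul_lt_top ENNReal.ofReal_lt_top (measure_lt_top _ _)

end

theorem ofReal_mul_survival_le_lintegral (F : Measure ℝ) (v : ℝ) :
    ENNReal.ofReal v * survival F v ≤ ∫⁻ x, ENNReal.ofReal x ∂F := by
  refine le_trans ?_ (mul_meas_ge_le_lintegral ENNReal.measurable_ofReal (ENNReal.ofReal v))
  gcongr
  exact measure_mono fun x (hx : v ≤ x) => ENNReal.ofReal_le_ofReal hx

/-! ### Membership of the family in the class and optimality of its parameter -/

theorem worstSurvival_of_lt {α r w q v : ℝ} (h : r < w) :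
    worstSurvival α r w q v = paretoSurvival α (GamInv α q) r (w - r) w v := by
  simp [worstSurvival, paretoSurvival, Hbar, h]

theorem worstSurvival_of_le {α r w q v : ℝ} (h : w ≤ r) :
    worstSurvival α r w q v = paretoSurvival α (GamInv α q) 0 w r v := by
  simp [worstSurvival, paretoSurvival, Hbar, h.not_gt]

theorem isProbabilityMeasure_worstLaw (α r w q : ℝ) :
    IsProbabilityMeasure (worstLaw α r w q) := by
  have : IsProbabilityMeasure (volume.restrict (Ioc (0 : ℝ) 1)) := ⟨by simp⟩
  exact Measure.isProbabilityMeasure_map (measurable_quantile α r w q).aemeasurable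

theorem priceRange_pos {α w q r : ℝ} (hα : α ≤ 1) (hw : 0 < w) (hq0 : 0 < q) (hq1 : q < 1)
    (hr : r ∈ priceRange α w q) : 0 < r := by
  have hb := GamInv_pos hα hq0 hq1
  rcases hr with h | h
  · exact lt_of_lt_of_le (by positivity) h.1
  · exact hw.trans_le h.1

theorem worstSurvival_self {α r w q : ℝ} (hα : α ≤ 1) (hw : 0 < w) (hq0 : 0 < q) :
    worstSurvival α r w q w = q := by
  rcases lt_or_ge r w with h | h
  · have : w - r ≠ 0 := (sub_pos.2 h).ne'
    simp [worstSurvival_of_lt h, paretoSurvival, h.not_ge, div_self this, Gam_GamInv hα hq0]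
  · simp [worstSurvival_of_le h, paretoSurvival, hw.not_ge, h, div_self hw.ne', Gam_GamInv hα hq0]

theorem worstLaw_mem_regularClass {α r w q : ℝ} (hα : α ≤ 1) (hw : 0 < w) (hq0 : 0 < q)
    (hq1 : q < 1) (hr : 0 < r) : worstLaw α r w q ∈ regularClass α w q := by
  have hb := GamInv_pos hα hq0 hq1
  have hprob := isProbabilityMeasure_worstLaw α r w q
  have hS := fun v => survival_worstLaw (r := r) hα hq0 hq1 hw v
  have hw' : survival (worstLaw α r w q) w = ENNReal.ofReal q := by
    rw [hS, worstSurvival_self hα hw hq0]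
  refine ⟨⟨hprob, ?_⟩, ?_, ?_, hw', ?_⟩
  · have h1 : survival (worstLaw α r w q) 0 = 1 := by
      rw [hS]
      rcases lt_or_ge r w with h | h
      · simp [worstSurvival_of_lt h, paretoSurvival, hr.le]
      · simp [worstSurvival_of_le h, paretoSurvival]
    rw [← compl_Ici]
    exact (prob_compl_eq_zero_iff measurableSet_Ici).2 h1
  · refine lt_of_lt_of_le ?_ (ofReal_mul_survival_le_lintegral _ w)
    rw [hw']
    exact ENNReal.mul_pos (ENNReal.ofReal_pos.2 hw).ne' (ENNReal.ofReal_pos.2 hq0).ne'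
  · rcases lt_or_ge r w with h | h
    · exact lintegral_lt_top_of_paretoSurvival h fun v => by rw [hS, worstSurvival_of_lt h]
    · exact lintegral_lt_top_of_paretoSurvival hr fun v => by rw [hS, worstSurvival_of_le h]
  · rcases lt_or_ge r w with h | h
    · exact isStronglyRegular_of_paretoSurvival hα hb (sub_pos.2 h) h fun v => by
        rw [hS, worstSurvival_of_lt h]
    · exact isStronglyRegular_of_paretoSurvival hα hb hw hr fun v => by
        rw [hS, worstSurvival_of_le h]

/-- If `r < w`, the lower bound on `r` means `w - r ≤ r Γ_α⁻¹(q)`, so a price with Pareto argument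
`x` is at most `r (1 + x)`, and `(1 + x) Γ_α(x) ≤ 1`. If `r ≥ w`, the upper bound keeps the argument
where `x Γ_α(x)` is non-decreasing. -/
theorem worst_revenue_le {α r w q : ℝ} (hα0 : 0 ≤ α) (hα : α ≤ 1) (hw : 0 < w) (hq0 : 0 < q)
    (hq1 : q < 1) (hr : r ∈ priceRange α w q) {v : ℝ} (hv : 0 ≤ v) :
    v * worstSurvival α r w q v ≤ r * worstSurvival α r w q r := by
  have hb := GamInv_pos hα hq0 hq1
  have hr0 := priceRange_pos hα hw hq0 hq1 hr
  rcases hr with ⟨h1, h2⟩ | ⟨h1, h2⟩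
  · rw [worstSurvival_of_lt h2, worstSurvival_of_lt h2]
    have hd : 0 < w - r := sub_pos.2 h2
    simp only [paretoSurvival, le_refl, if_true, mul_one]
    split_ifs with h3 h4
    · linarith
    · have hx := paretoArg_nonneg hb hd (not_le.1 h3).le
      have h5 := one_add_mul_Gam_le_one hα0 hα hx
      have h6 : v ≤ r * (1 + GamInv α q * ((v - r) / (w - r))) := by
        rw [div_le_iff₀ (by positivity)] at h1
        have : w - r ≤ r * GamInv α q := by linarith
        have h7 : 0 ≤ (v - r) / (w - r) := div_nonneg (by linarith) hd.le
        have h8 := mul_le_mul_of_nonneg_right this h7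
        rw [mul_div_cancel₀ _ hd.ne'] at h8
        linarith
      calc v * Gam α (GamInv α q * ((v - r) / (w - r)))
          ≤ r * (1 + GamInv α q * ((v - r) / (w - r))) * Gam α (GamInv α q * ((v - r) / (w - r))) :=
            mul_le_mul_of_nonneg_right h6 (Gam_pos hα hx).le
        _ ≤ r := by rw [mul_assoc]; exact mul_le_of_le_one_right hr0.le h5
    · rw [mul_zero]
      exact hr0.le
  · rw [worstSurvival_of_le h1, worstSurvival_of_le h1]
    have hy : α * (GamInv α q * (r / w)) ≤ 1 := by
      rcases h2 with h2 | h2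
      · simp [h2]
      · rcases hα0.eq_or_lt with h | h
        · simp [← h]
        · rw [le_div_iff₀ (by positivity)] at h2
          rw [← mul_assoc, mul_div_assoc', div_le_one hw]
          linarith
    simp only [paretoSurvival, hr0.not_ge, if_false, le_refl, if_true, sub_zero]
    split_ifs with h3 h4
    · rw [le_antisymm h3 hv, zero_mul]
      exact mul_nonneg hr0.le (Gam_pos hα (by positivity)).le
    · have h5 : GamInv α q * (v / w) ≤ GamInv α q * (r / w) := by gcongr
      have h6 := mul_Gam_le_mul_Gam hα0 hα (by positivity) h5 hy
      have h7 : 0 < GamInv α q / w := by positivity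
      refine le_of_mul_le_mul_left ?_ h7
      calc GamInv α q / w * (v * Gam α (GamInv α q * (v / w)))
          = GamInv α q * (v / w) * Gam α (GamInv α q * (v / w)) := by ring
        _ ≤ GamInv α q * (r / w) * Gam α (GamInv α q * (r / w)) := h6
        _ = _ := by ring
    · rw [mul_zero]
      exact mul_nonneg hr0.le (Gam_pos hα (by positivity)).le

theorem isOptimalPrice_worstLaw {α r w q : ℝ} (hα0 : 0 ≤ α) (hα : α ≤ 1) (hw : 0 < w)
    (hq0 : 0 < q) (hq1 : q < 1) (hr : r ∈ priceRange α w q) :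
    IsOptimalPrice (worstLaw α r w q) r := by
  have hr0 := priceRange_pos hα hw hq0 hq1 hr
  refine ⟨hr0.le, le_antisymm (le_iSup₂_of_le r hr0.le le_rfl) (iSup₂_le fun v hv => ?_)⟩
  rw [survival_worstLaw hα hq0 hq1 hw, survival_worstLaw hα hq0 hq1 hw,
    ← ENNReal.ofReal_mul hv, ← ENNReal.ofReal_mul hr0.le]
  exact ENNReal.ofReal_le_ofReal (worst_revenue_le hα0 hα hw hq0 hq1 hr hv)

/-! ### Tangent bounds and integration by parts -/

/-- The generalized Pareto survival function is convex: it lies above its tangents. -/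
theorem tangent_le_Gam {α y z : ℝ} (hα : α ≤ 1) (hy : 0 ≤ y) (hz : 0 ≤ z) :
    Gam α y - Gam α y / (1 + (1 - α) * y) * (z - y) ≤ Gam α z := by
  have hd : ∀ x ∈ Ici (0 : ℝ), HasDerivAt (Gam α) (-(Gam α x / (1 + (1 - α) * x))) x :=
    fun x hx => hasDerivAt_Gam (base_pos hα hx)
  have hconv : ConvexOn ℝ (Ici 0) (Gam α) := by
    refine MonotoneOn.convexOn_of_deriv (convex_Ici 0)
      (fun x hx => (hd x hx).continuousAt.continuousWithinAt)
      (fun x hx => (hd x (interior_subset hx)).differentiableAt.differentiableWithinAt) ?_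
    intro x hx x' hx' hxx
    have h0 : (0 : ℝ) ≤ x := interior_subset hx
    rw [(hd x h0).deriv, (hd x' (interior_subset hx')).deriv]
    have h1 := Gam_le_of_le hα h0 hxx
    have h2 := base_pos hα h0
    have h3 := Gam_pos hα h0
    have h4 := mul_le_mul_of_nonneg_left hxx (sub_nonneg.2 hα)
    refine neg_le_neg (div_le_div₀ h3.le h1 h2 (by linarith))
  rcases lt_trichotomy y z with h | h | h
  · have := hconv.le_slope_of_hasDerivAt (show y ∈ Ici (0 : ℝ) from hy) hz h (hd y hy)
    rw [slope_def_field, le_div_iff₀ (sub_pos.2 h)] at this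
    linarith
  · simp [h]
  · have := hconv.slope_le_of_hasDerivAt (show z ∈ Ici (0 : ℝ) from hz) hy h (hd y hy)
    rw [slope_def_field, div_le_iff₀ (sub_pos.2 h)] at this
    linarith

theorem Gam_le_of_GamInv_le {α u x : ℝ} (hα : α ≤ 1) (hu : 0 < u) (hu1 : u ≤ 1)
    (h : GamInv α u ≤ x) : Gam α x ≤ u :=
  (Gam_le_of_le hα (GamInv_nonneg hα hu hu1) h).trans_eq (Gam_GamInv hα hu)

/-- Integration by parts for a primitive `G` of `-f` and a `C¹` function `K`. -/
theorem mul_sub_mul_eq_integral {G f K K' : ℝ → ℝ} {a b : ℝ} (hab : a ≤ b)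
    (hf : IntervalIntegrable f volume a b)
    (hG : ∀ x ∈ Icc a b, G x = G a - ∫ t in a..x, f t)
    (hK : ∀ x ∈ Icc a b, ContDiffAt ℝ 1 K x)
    (hK' : ∀ x ∈ Icc a b, HasDerivAt K (K' x) x) :
    G b * K b - G a * K a = ∫ x in Ioo a b, (G x * K' x - f x * K x) := by
  set P : ℝ → ℝ := fun x => ∫ t in a..x, f t with hP
  have hPac : AbsolutelyContinuousOnInterval P a b :=
    hf.absolutelyContinuousOnInterval_intervalIntegral left_mem_uIcc
  have hCac : AbsolutelyContinuousOnInterval (fun _ : ℝ => G a) a b :=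
    (contDiffOn_const (c := G a)).absolutelyContinuousOnInterval
  have hKac : AbsolutelyContinuousOnInterval K a b := by
    refine ContDiffOn.absolutelyContinuousOnInterval fun x hx => ?_
    rw [uIcc_of_le hab] at hx
    exact (hK x hx).contDiffWithinAt
  have h := (hCac.sub hPac).integral_deriv_mul_eq_sub hKac
  simp only [Pi.sub_apply] at h
  rw [hG b (right_mem_Icc.2 hab), hG a (left_mem_Icc.2 hab)]
  simp only [hP, intervalIntegral.integral_same, sub_zero] at h ⊢
  rw [← h, intervalIntegral.integral_of_le hab, integral_Ioc_eq_integral_Ioo]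
  refine setIntegral_congr_ae measurableSet_Ioo ?_
  -- The density is only integrable: `G` is absolutely continuous and has derivative `-f` merely
  -- almost everywhere.
  filter_upwards [hf.ae_hasDerivAt_integral] with x hx hxab
  have hxI : x ∈ Icc a b := Ioo_subset_Icc_self hxab
  have h1 := hx (by rwa [uIcc_of_le hab]) a left_mem_uIcc
  have h2 : HasDerivAt ((fun _ : ℝ => G a) - fun x => ∫ t in a..x, f t) (0 - f x) x :=
    (hasDerivAt_const x (G a)).sub h1
  rw [h2.deriv, (hK' x hxI).deriv, hG x hxI]
  ring

/-! ### The transformed survival function of a strongly regular law is convex -/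

/-- The survival function as a real-valued function. -/
def surv (F : Measure ℝ) (v : ℝ) : ℝ := (survival F v).toReal

section

variable {F : Measure ℝ} {α : ℝ}

theorem ofReal_surv [IsFiniteMeasure F] (v : ℝ) : ENNReal.ofReal (surv F v) = survival F v :=
  ENNReal.ofReal_toReal (measure_ne_top _ _)

theorem surv_anti [IsFiniteMeasure F] : Antitone (surv F) := fun _ _ h =>
  ENNReal.toReal_mono (measure_ne_top _ _) (survival_anti F h)

theorem surv_nonneg (v : ℝ) : 0 ≤ surv F v := ENNReal.toReal_nonneg

theorem surv_le_one [IsProbabilityMeasure F] (v : ℝ) : surv F v ≤ 1 :=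
  ENNReal.toReal_le_of_le_ofReal zero_le_one (by rw [ENNReal.ofReal_one]; exact prob_le_one)

theorem surv_zero [IsProbabilityMeasure F] (h : F (Iio 0) = 0) : surv F 0 = 1 := by
  unfold surv survival
  rw [← compl_Ici] at h
  rw [(prob_compl_eq_zero_iff measurableSet_Ici).1 h]
  simp

theorem surv_pos_of_mem_belowMax [IsFiniteMeasure F] {v : ℝ} (h : v ∈ belowMax F) :
    0 < surv F v :=
  ENNReal.toReal_pos ((show 0 < F (Ioi v) from h).trans_le (measure_mono Ioi_subset_Ici_self)).ne'
    (measure_ne_top _ _)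

theorem mem_belowMax_of_lt {u v : ℝ} (huv : u < v) (hv : 0 < surv F v) : u ∈ belowMax F :=
  (ENNReal.toReal_pos_iff.1 hv).1.trans_le (measure_mono fun _ (hx : v ≤ _) => huv.trans_le hx)

variable {f : ℝ → ℝ≥0}

/-- Since `v` has positive survival, `[u, v)` stays strictly below the maximum of the support, so a
possible atom there is not counted. -/
theorem measure_Ico_eq_setLIntegral
    (hden : F.restrict (belowMax F) =
      (volume.restrict (belowMax F)).withDensity (fun v => (f v : ℝ≥0∞)))
    {u v : ℝ} (hv : 0 < surv F v) :
    F (Ico u v) = ∫⁻ x in Ico u v, (f x : ℝ≥0∞) := by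
  have hsub : Ico u v ⊆ belowMax F := fun x hx => mem_belowMax_of_lt hx.2 hv
  have h := congrArg (fun μ : Measure ℝ => μ (Ico u v)) hden
  simp only [Measure.restrict_apply measurableSet_Ico, withDensity_apply _ measurableSet_Ico,
    Measure.restrict_restrict measurableSet_Ico, inter_eq_left.2 hsub] at h
  exact h

theorem intervalIntegrable_density [IsFiniteMeasure F] (hf : Measurable f)
    (hden : F.restrict (belowMax F) =
      (volume.restrict (belowMax F)).withDensity (fun v => (f v : ℝ≥0∞)))
    {u v : ℝ} (huv : u ≤ v) (hv : 0 < surv F v) :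
    IntervalIntegrable (fun x => (f x : ℝ)) volume u v := by
  rw [intervalIntegrable_iff_integrableOn_Ico_of_le huv]
  refine ⟨hf.coe_nnreal_real.aestronglyMeasurable, ?_⟩
  rw [hasFiniteIntegral_iff_ofReal (f := fun x => (f x : ℝ))
    (Filter.Eventually.of_forall fun x => NNReal.coe_nonneg (f x))]
  simp only [ENNReal.ofReal_coe_nnreal]
  rw [← measure_Ico_eq_setLIntegral hden hv]
  exact measure_lt_top _ _

theorem surv_eq_sub_integral [IsFiniteMeasure F] (hf : Measurable f)
    (hden : F.restrict (belowMax F) =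
      (volume.restrict (belowMax F)).withDensity (fun v => (f v : ℝ≥0∞)))
    {u v : ℝ} (huv : u ≤ v) (hv : 0 < surv F v) :
    surv F v = surv F u - ∫ x in u..v, (f x : ℝ) := by
  have h1 : F (Ico u v) = survival F u - survival F v := by
    rw [← Ici_sdiff_Ici]
    exact measure_sdiff (Ici_subset_Ici.2 huv) measurableSet_Ici.nullMeasurableSet
      (measure_ne_top _ _)
  have h2 : ∫ x in u..v, (f x : ℝ) = (F (Ico u v)).toReal := by
    rw [intervalIntegral.integral_of_le huv, integral_Ioc_eq_integral_Ioo,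
      ← integral_Ico_eq_integral_Ioo, integral_eq_lintegral_of_nonneg_ae (f := fun x => (f x : ℝ))
        (Filter.Eventually.of_forall fun x => NNReal.coe_nonneg (f x))
        hf.coe_nnreal_real.aestronglyMeasurable]
    simp only [ENNReal.ofReal_coe_nnreal]
    rw [measure_Ico_eq_setLIntegral hden hv]
  rw [h2, h1, ENNReal.toReal_sub_of_le (survival_anti F huv) (measure_ne_top _ _)]
  unfold surv
  ring

theorem virtualValue_of_density_eq_zero [IsFiniteMeasure F] {v : ℝ} (hv : v ∈ belowMax F)
    (h : f v = 0) : virtualValue α F f v = ⊥ := by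
  have h0 : survival F v ≠ 0 := fun h0 => by
    have := surv_pos_of_mem_belowMax hv
    simp [surv, h0] at this
  simp [virtualValue, h, ENNReal.div_zero h0]

theorem virtualValue_of_density_ne_zero [IsFiniteMeasure F] {v : ℝ} (h : f v ≠ 0) :
    virtualValue α F f v = (((1 - α) * v - surv F v / f v : ℝ) : EReal) := by
  have h1 : (0 : ℝ) < f v := NNReal.coe_pos.2 (pos_iff_ne_zero.2 h)
  unfold virtualValue
  rw [← ofReal_surv, ← ENNReal.ofReal_coe_nnreal (p := f v), ← ENNReal.ofReal_div_of_pos h1,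
    EReal.coe_ennreal_ofReal, max_eq_left (div_nonneg (surv_nonneg v) h1.le), ← EReal.coe_sub]

/-- The transformed survival function `Γ_α⁻¹ ∘ F̄` of an `α`-strongly regular law has a supporting
line at every point below the maximum of the support. -/
theorem IsStronglyRegular.exists_supporting_line [IsProbabilityMeasure F] (hα : α ≤ 1)
    (hF0 : F (Iio 0) = 0) (hF : IsStronglyRegular α F) {p : ℝ} (hp0 : 0 ≤ p)
    (hp : p ∈ belowMax F) :
    ∃ γ : ℝ, ∀ v, 0 ≤ v → 0 < surv F v →
      GamInv α (surv F p) + γ * (v - p) ≤ GamInv α (surv F v) := by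
  obtain ⟨f, hf, hden, hmono⟩ := hF
  have hGp := surv_pos_of_mem_belowMax hp
  rcases eq_or_ne (f p) 0 with hfp | hfp
  -- A zero density at `p` makes the virtual value `-∞` there, hence on all of `[0, p]`. The density
  -- vanishes on that interval, `F̄(p) = 1`, and the zero line supports.
  · refine ⟨0, fun v _ hv => ?_⟩
    have hzero : ∀ x ∈ uIcc 0 p, (f x : ℝ) = 0 := by
      intro x hx
      rw [uIcc_of_le hp0] at hx
      by_contra hne
      have hne' : f x ≠ 0 := by exact_mod_cast hne
      have hxm : x ∈ belowMax F := by
        rcases hx.2.eq_or_lt with h | h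
        · rwa [h]
        · exact mem_belowMax_of_lt h hGp
      have := hmono ⟨hx.1, hxm⟩ ⟨hp0, hp⟩ hx.2
      rw [virtualValue_of_density_eq_zero hp hfp, virtualValue_of_density_ne_zero hne'] at this
      exact EReal.coe_ne_bot _ (le_bot_iff.1 this)
    have h1 := surv_eq_sub_integral hf hden hp0 hGp
    rw [intervalIntegral.integral_congr hzero, intervalIntegral.integral_zero, sub_zero,
      surv_zero hF0] at h1
    rw [h1, GamInv_one, zero_mul, add_zero]
    exact GamInv_nonneg hα hv (surv_le_one v)
  · have hfp0 : (0 : ℝ) < f p := NNReal.coe_pos.2 (pos_iff_ne_zero.2 hfp)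
    set g := GamInv α (surv F p) with hg
    have hg0 : 0 ≤ g := GamInv_nonneg hα hGp (surv_le_one p)
    have hbase := base_pos hα hg0
    set e := surv F p / f p with he
    have he0 : 0 < e := div_pos hGp hfp0
    -- The slope the chain rule suggests for `Γ_α⁻¹ ∘ F̄` at `p`, with `e` the inverse hazard rate.
    set γ := (1 + (1 - α) * g) / e with hγ
    have hγ0 : 0 < γ := div_pos hbase he0
    refine ⟨γ, fun v hv0 hv => ?_⟩
    set L : ℝ → ℝ := fun x => g + γ * (x - p) with hL
    change L v ≤ _
    have hLp : L p = g := by simp [hL]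
    have hLbase : ∀ x, 1 + (1 - α) * L x = γ * (e + (1 - α) * (x - p)) := by
      intro x
      have : γ * e = 1 + (1 - α) * g := div_mul_cancel₀ _ he0.ne'
      simp only [hL]
      linear_combination -this
    have hLmono : ∀ x y, x ≤ y → L x ≤ L y := fun x y hxy => by
      simp only [hL]
      gcongr
    rcases lt_or_ge (L v) 0 with hneg | hLv
    · exact hneg.le.trans (GamInv_nonneg hα hv (surv_le_one v))
    rw [le_GamInv_iff hα hLv hv (surv_le_one v)]
    -- A Grönwall argument: `F̄ K` equals `1` at `p`, and it is enough that it be at most `1` at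
    -- `v`. The logarithmic derivative of `K` is `1 / (e + (1 - α) (x - p))`.
    set K : ℝ → ℝ := fun x => (Gam α (L x))⁻¹ with hK
    have hKd : ∀ x, 0 ≤ L x → HasDerivAt K (K x / (e + (1 - α) * (x - p))) x := by
      intro x hx
      have h1 : HasDerivAt L γ x := by
        simpa [hL] using (((hasDerivAt_id x).sub_const p).const_mul γ).const_add g
      have h2 := (hasDerivAt_inv_Gam (base_pos hα hx)).comp x h1
      have h3 : (Gam α (L x))⁻¹ / (1 + (1 - α) * L x) * γ =
          K x / (e + (1 - α) * (x - p)) := by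
        rw [hLbase, hK, div_mul_eq_mul_div, mul_comm (Gam α (L x))⁻¹ γ,
          mul_div_mul_left _ _ hγ0.ne']
      rw [h3] at h2
      exact h2
    have hKc : ∀ x, 0 ≤ L x → ContDiffAt ℝ 1 K x := by
      intro x hx
      have h1 : ContDiffAt ℝ 1 L x := by
        simp only [hL]
        fun_prop
      exact ((contDiffAt_Gam (base_pos hα hx)).comp x h1).inv (Gam_pos hα hx).ne'
    have hden_pos : ∀ x, 0 ≤ L x → 0 < e + (1 - α) * (x - p) := by
      intro x hx
      have := base_pos hα hx
      rw [hLbase] at this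
      exact pos_of_mul_pos_right this hγ0.le
    have hKpos : ∀ x, 0 ≤ L x → 0 < K x := fun x hx => inv_pos.2 (Gam_pos hα hx)
    have hGK : surv F p * K p = 1 := by
      simp only [hK, hLp, hg, Gam_GamInv hα hGp]
      exact mul_inv_cancel₀ hGp.ne'
    suffices h : surv F v * K v ≤ 1 by
      simp only [hK] at h
      rwa [← div_eq_mul_inv, div_le_one (Gam_pos hα hLv)] at h
    -- Monotonicity of the virtual value bounds `F̄ / f` by `e + (1 - α) (x - p)`, from above to the
    -- right of `p` and from below to its left. So `F̄ K` decreases after `p` and increases before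
    -- it.
    rcases le_total p v with hpv | hvp
    · have hLx : ∀ x ∈ Icc p v, 0 ≤ L x := fun x hx => hg0.trans (hLp ▸ hLmono p x hx.1)
      have h1 := mul_sub_mul_eq_integral (G := surv F) hpv
        (intervalIntegrable_density hf hden hpv hv)
        (fun x hx => surv_eq_sub_integral hf hden hx.1 (hv.trans_le (surv_anti hx.2)))
        (fun x hx => hKc x (hLx x hx)) (fun x hx => hKd x (hLx x hx))
      have h2 : ∫ x in Ioo p v,
          (surv F x * (K x / (e + (1 - α) * (x - p))) - (f x : ℝ) * K x) ≤ 0 := by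
        refine setIntegral_nonpos measurableSet_Ioo fun x hx => ?_
        have hLx' := hLx x (Ioo_subset_Icc_self hx)
        have hxm : x ∈ belowMax F := mem_belowMax_of_lt hx.2 hv
        have hm := hmono ⟨hp0, hp⟩ ⟨hp0.trans hx.1.le, hxm⟩ hx.1.le
        rw [virtualValue_of_density_ne_zero hfp] at hm
        have hfx : f x ≠ 0 := fun h0 => by
          rw [virtualValue_of_density_eq_zero hxm h0] at hm
          exact EReal.coe_ne_bot _ (le_bot_iff.1 hm)
        rw [virtualValue_of_density_ne_zero hfx, EReal.coe_le_coe_iff] at hm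
        have hfx0 : (0 : ℝ) < f x := NNReal.coe_pos.2 (pos_iff_ne_zero.2 hfx)
        have hd := hden_pos x hLx'
        have h3 : surv F x / f x ≤ e + (1 - α) * (x - p) := by linarith
        rw [div_le_comm₀ hfx0 hd] at h3
        have h4 := mul_le_mul_of_nonneg_right h3 (hKpos x hLx').le
        have h5 : surv F x * (K x / (e + (1 - α) * (x - p))) =
            surv F x / (e + (1 - α) * (x - p)) * K x := by ring
        linarith
      linarith
    · have hLx : ∀ x ∈ Icc v p, 0 ≤ L x := fun x hx => hLv.trans (hLmono v x hx.1)
      have h1 := mul_sub_mul_eq_integral (G := surv F) hvp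
        (intervalIntegrable_density hf hden hvp hGp)
        (fun x hx => surv_eq_sub_integral hf hden hx.1 (hGp.trans_le (surv_anti hx.2)))
        (fun x hx => hKc x (hLx x hx)) (fun x hx => hKd x (hLx x hx))
      have h2 : 0 ≤ ∫ x in Ioo v p,
          (surv F x * (K x / (e + (1 - α) * (x - p))) - (f x : ℝ) * K x) := by
        refine setIntegral_nonneg measurableSet_Ioo fun x hx => ?_
        have hLx' := hLx x (Ioo_subset_Icc_self hx)
        have hxm : x ∈ belowMax F := mem_belowMax_of_lt hx.2 hGp
        have hd := hden_pos x hLx'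
        have h5 : surv F x * (K x / (e + (1 - α) * (x - p))) =
            surv F x / (e + (1 - α) * (x - p)) * K x := by ring
        have h3 : (f x : ℝ) ≤ surv F x / (e + (1 - α) * (x - p)) := by
          rcases eq_or_ne (f x) 0 with hfx | hfx
          · rw [hfx]
            exact div_nonneg (surv_nonneg x) hd.le
          · have hm := hmono ⟨hv0.trans hx.1.le, hxm⟩ ⟨hp0, hp⟩ hx.2.le
            rw [virtualValue_of_density_ne_zero hfp, virtualValue_of_density_ne_zero hfx,
              EReal.coe_le_coe_iff] at hm
            have hfx0 : (0 : ℝ) < f x := NNReal.coe_pos.2 (pos_iff_ne_zero.2 hfx)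
            rw [le_div_comm₀ hfx0 hd]
            linarith
        have h4 := mul_le_mul_of_nonneg_right h3 (hKpos x hLx').le
        linarith
      linarith

theorem IsStronglyRegular.convex_chord [IsProbabilityMeasure F] (hα : α ≤ 1)
    (hF0 : F (Iio 0) = 0) (hF : IsStronglyRegular α F) {a p c : ℝ} (ha : 0 ≤ a)
    (hap : a ≤ p) (hpc : p ≤ c) (hc : 0 < surv F c) :
    (c - a) * GamInv α (surv F p) ≤
      (c - p) * GamInv α (surv F a) + (p - a) * GamInv α (surv F c) := by
  -- The case `p = c` is separate because `c` may be the maximum of the support, where no supporting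
  -- line is available. Otherwise the line at `p` is evaluated at `a` and `c`.
  rcases hpc.eq_or_lt with rfl | hpc
  · linarith
  · obtain ⟨γ, hγ⟩ :=
      hF.exists_supporting_line hα hF0 (ha.trans hap) (mem_belowMax_of_lt hpc hc)
    have h1 := hγ a ha (hc.trans_le (surv_anti (hap.trans hpc.le)))
    have h2 := hγ c (ha.trans (hap.trans hpc.le)) hc
    have h3 := mul_le_mul_of_nonneg_left h1 (sub_pos.2 hpc).le
    have h4 := mul_le_mul_of_nonneg_left h2 (sub_nonneg.2 hap)
    linarith

/-! ### Existence of an optimal price -/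

/-- Outer regularity of `F` on `[v, ∞)` controls the survival function slightly to the left of `v`;
to the right, monotonicity suffices. -/
theorem upperSemicontinuous_survival [IsFiniteMeasure F] : UpperSemicontinuous (survival F) := by
  intro v y hy
  obtain ⟨U, hvU, hU, hUy⟩ := (Ici v).exists_isOpen_lt_of_lt y hy
  obtain ⟨l, hl, hlU⟩ := exists_Ioc_subset_of_mem_nhds (hU.mem_nhds (hvU self_mem_Ici))
    (exists_lt v)
  filter_upwards [Ioi_mem_nhds hl] with x hx
  refine (measure_mono fun z (hz : x ≤ z) => ?_).trans_lt hUy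
  rcases le_total z v with h | h
  · exact hlU ⟨lt_of_lt_of_le hx hz, h⟩
  · exact hvU h

theorem upperSemicontinuousOn_mul_surv [IsFiniteMeasure F] (s : Set ℝ) (hs : s ⊆ Ici 0) :
    UpperSemicontinuousOn (fun v => v * surv F v) s := by
  intro v hv y hy
  have hcont : Filter.Tendsto (fun e : ℝ => (v + e) * (surv F v + e)) (nhdsWithin 0 (Ioi 0))
      (nhds (v * surv F v)) := by
    have : Continuous fun e : ℝ => (v + e) * (surv F v + e) := by fun_prop
    simpa using (this.tendsto 0).mono_left nhdsWithin_le_nhds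
  obtain ⟨e, hey, he⟩ := ((hcont.eventually_lt_const hy).and self_mem_nhdsWithin).exists
  have he0 : 0 < e := he
  have h1 : survival F v < ENNReal.ofReal (surv F v + e) := by
    rw [← ofReal_surv]
    exact ENNReal.ofReal_lt_ofReal_iff_of_nonneg (surv_nonneg v) |>.2 (by linarith)
  have h2 : ∀ᶠ x in nhds v, survival F x < ENNReal.ofReal (surv F v + e) :=
    upperSemicontinuous_survival v _ h1
  filter_upwards [nhdsWithin_le_nhds h2, nhdsWithin_le_nhds (Iio_mem_nhds (by linarith : v < v + e)),
    self_mem_nhdsWithin] with x hx hxe hxs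
  refine lt_of_le_of_lt ?_ hey
  have h3 : surv F x ≤ surv F v + e :=
    ENNReal.toReal_le_of_le_ofReal (add_nonneg (surv_nonneg v) he0.le) hx.le
  exact mul_le_mul (le_of_lt hxe) h3 (surv_nonneg x) (by linarith [show (0 : ℝ) ≤ v from hs hv])

/-- The revenue at `v` is at most the tail integral of the mean over `[v, ∞)`, which tends to `0`.
High prices thus earn no more than `w`, and an upper semicontinuous function attains its maximum on
the remaining compact interval. -/
theorem exists_maximal_revenue [IsFiniteMeasure F] (hE : ∫⁻ v, ENNReal.ofReal v ∂F < ∞) {w : ℝ}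
    (hw : 0 < w) (hq : 0 < surv F w) :
    ∃ r, 0 ≤ r ∧ ∀ v, 0 ≤ v → v * surv F v ≤ r * surv F r := by
  have : IsFiniteMeasure (F.withDensity ENNReal.ofReal) := isFiniteMeasure_withDensity hE.ne
  have hlim : Filter.Tendsto (fun v => F.withDensity ENNReal.ofReal (Ici v)) Filter.atTop
      (nhds 0) := by
    have h := tendsto_measure_iInter_atTop (μ := F.withDensity ENNReal.ofReal)
      (s := fun v : ℝ => Ici v) (fun v => measurableSet_Ici.nullMeasurableSet)
      (fun _ _ h => Ici_subset_Ici.2 h) ⟨0, measure_ne_top _ _⟩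
    have h0 : ⋂ v : ℝ, Ici v = ∅ := by
      refine eq_empty_of_forall_notMem fun x hx => ?_
      have : x + 1 ≤ x := mem_iInter.1 hx (x + 1)
      linarith
    rwa [h0, measure_empty] at h
  have hpos : 0 < ENNReal.ofReal (w * surv F w) := ENNReal.ofReal_pos.2 (mul_pos hw hq)
  obtain ⟨B, hB⟩ := Filter.eventually_atTop.1 (hlim.eventually_lt_const hpos)
  have htail : ∀ v, 0 ≤ v → B ≤ v → v * surv F v ≤ w * surv F w := by
    intro v hv0 hv
    have h1 : ENNReal.ofReal v * survival F v ≤ F.withDensity ENNReal.ofReal (Ici v) := by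
      rw [withDensity_apply _ measurableSet_Ici]
      calc ENNReal.ofReal v * survival F v = ∫⁻ _ in Ici v, ENNReal.ofReal v ∂F := by
            rw [setLIntegral_const]
            rfl
        _ ≤ _ := setLIntegral_mono' measurableSet_Ici fun x hx => ENNReal.ofReal_le_ofReal hx
    have h2 := h1.trans (hB v hv).le
    rw [← ofReal_surv, ← ENNReal.ofReal_mul hv0] at h2
    exact (ENNReal.ofReal_le_ofReal_iff (mul_pos hw hq).le).1 h2
  obtain ⟨r, hr, hmax⟩ := UpperSemicontinuousOn.exists_isMaxOn
    (nonempty_Icc.2 (hw.le.trans (le_max_right B w))) isCompact_Icc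
    (upperSemicontinuousOn_mul_surv (F := F) (Icc 0 (max B w)) fun x hx => hx.1)
  refine ⟨r, hr.1, fun v hv => ?_⟩
  rcases le_or_gt v (max B w) with h | h
  · exact hmax ⟨hv, h⟩
  · exact (htail v hv ((le_max_left _ _).trans h.le)).trans
      (hmax ⟨hw.le, le_max_right _ _⟩)

end

/-! ### Comparison with the candidate worst case -/

section

variable {F : Measure ℝ} {α w q r : ℝ}

/-- Conditionally on `v ≥ r`, survival at `w` is at least `q`. The chord from `r` to `w` of the
conditional transform thus lies below that of the family member, and `Γ_α` reverses the order. -/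
theorem mul_paretoGam_le_surv [IsProbabilityMeasure F] (hα : α ≤ 1) (hF0 : F (Iio 0) = 0)
    (hF : IsStronglyRegular α F) (hq0 : 0 < q) (hq : surv F w = q) (hr : 0 ≤ r)
    (hrw : r < w) {p : ℝ} (hrp : r ≤ p) (hpw : p ≤ w) :
    surv F r * Gam α (GamInv α q * ((p - r) / (w - r))) ≤ surv F p := by
  have hGw : 0 < surv F w := hq ▸ hq0
  have hGr : 0 < surv F r := hGw.trans_le (surv_anti hrw.le)
  have hGp : 0 < surv F p := hGw.trans_le (surv_anti hpw)
  have hd : 0 < w - r := sub_pos.2 hrw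
  have hchord := hF.convex_chord hα hF0 hr hrp hpw hGw
  have h1 : GamInv α (surv F p / surv F r) ≤ GamInv α q * ((p - r) / (w - r)) := by
    have h2 : GamInv α (surv F w / surv F r) ≤ GamInv α q := by
      refine GamInv_le_of_le hα hq0 ?_
      rw [hq, le_div_iff₀ hGr]
      exact mul_le_of_le_one_right hq0.le (surv_le_one r)
    rw [GamInv_div hα hGw hGr] at h2
    rw [GamInv_div hα hGp hGr, mul_div_assoc', le_div_iff₀ hd]
    have hc := (Real.rpow_pos_of_pos hGr (1 - α)).le
    have h3 := mul_le_mul_of_nonneg_left hchord hc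
    have h4 := mul_le_mul_of_nonneg_right h2 (sub_nonneg.2 hrp)
    linarith
  have h2 := Gam_le_of_GamInv_le hα (div_pos hGp hGr)
    ((div_le_one hGr).2 (surv_anti hrp)) h1
  rwa [le_div_iff₀' hGr] at h2

/-- The transform is convex and vanishes at `0`, so it lies below the chord from the origin. -/
theorem GamInv_surv_le [IsProbabilityMeasure F] (hα : α ≤ 1) (hF0 : F (Iio 0) = 0)
    (hF : IsStronglyRegular α F) (hGr : 0 < surv F r) {p : ℝ} (hp : 0 ≤ p) (hpr : p ≤ r) :
    r * GamInv α (surv F p) ≤ p * GamInv α (surv F r) := by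
  have h := hF.convex_chord hα hF0 le_rfl hp hpr hGr
  rw [surv_zero hF0, GamInv_one] at h
  linarith

theorem maximal_price_mem_priceRange [IsProbabilityMeasure F] (hα0 : 0 ≤ α) (hα : α ≤ 1)
    (hw : 0 < w) (hF0 : F (Iio 0) = 0) (hF : IsStronglyRegular α F) (hq0 : 0 < q)
    (hq1 : q < 1) (hq : surv F w = q) (hr : 0 < r) (hGr : 0 < surv F r)
    (hmax : ∀ v, 0 ≤ v → v * surv F v ≤ r * surv F r) : r ∈ priceRange α w q := by
  have hb := GamInv_pos hα hq0 hq1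
  rcases lt_or_ge r w with hrw | hwr
  · refine Or.inl ⟨?_, hrw⟩
    have hd : 0 < w - r := sub_pos.2 hrw
    -- Right-hand first-order condition: the optimal revenue at `r` is compared with that at `p >
    -- r`, using the Pareto minorant and the tangent of `Γ_α` at `0`. Letting `p` decrease to `r`
    -- gives the lower bound.
    have key : ∀ p, r < p → p ≤ w → w - r ≤ p * GamInv α q := by
      intro p hrp hpw
      have hp0 := hr.trans hrp
      have h1 := mul_paretoGam_le_surv hα hF0 hF hq0 hq hr.le hrw hrp.le hpw
      have h2 := tangent_le_Gam hα le_rfl (paretoArg_nonneg hb hd hrp.le)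
      simp only [Gam_zero, mul_zero, add_zero, div_one, one_mul, sub_zero] at h2
      have h3 : p * (1 - GamInv α q * ((p - r) / (w - r))) ≤ r := by
        refine le_of_mul_le_mul_left ?_ hGr
        calc surv F r * (p * (1 - GamInv α q * ((p - r) / (w - r))))
            = p * (surv F r * (1 - GamInv α q * ((p - r) / (w - r)))) := by ring
          _ ≤ p * (surv F r * Gam α (GamInv α q * ((p - r) / (w - r)))) := by gcongr
          _ ≤ p * surv F p := by gcongr
          _ ≤ r * surv F r := hmax p hp0.le
          _ = surv F r * r := mul_comm _ _
      have h4 : (p - r) * 1 ≤ (p - r) * (p * GamInv α q / (w - r)) := by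
        have : p * (GamInv α q * ((p - r) / (w - r))) =
          (p - r) * (p * GamInv α q / (w - r)) := by ring
        linarith
      have h5 := le_of_mul_le_mul_left h4 (sub_pos.2 hrp)
      rwa [one_le_div hd] at h5
    have hlim : (w - r) / GamInv α q ≤ r := by
      refine le_of_forall_gt_imp_ge_of_dense fun p hp => ?_
      rw [div_le_iff₀ hb]
      rcases le_total p w with h | h
      · exact key p hp h
      · exact (key w hrw le_rfl).trans (by gcongr)
    rw [div_le_iff₀ hb] at hlim
    rw [div_le_iff₀ (by positivity)]
    linarith
  · refine Or.inr ⟨hwr, ?_⟩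
    rcases hα0.eq_or_lt with h0 | h0
    · exact Or.inl h0.symm
    · right
      set y := GamInv α (surv F r) with hy
      have hy0 : 0 ≤ y := GamInv_nonneg hα hGr (surv_le_one r)
      have hΓy : Gam α y = surv F r := Gam_GamInv hα hGr
      have hby := GamInv_surv_le hα hF0 hF hGr hw.le hwr
      rw [hq] at hby
      have hD := base_pos hα hy0
      -- Left-hand first-order condition: prices `t r` are tested using the tangent of `Γ_α` at `y`.
      -- Letting `t` tend to `1` gives `α y ≤ 1`, which `hby` turns into the bound on `r`.
      have key : ∀ t, 0 < t → t < 1 → t * y ≤ 1 + (1 - α) * y := by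
        intro t ht0 ht1
        have h1 := tangent_le_Gam hα hy0 (mul_nonneg ht0.le hy0)
        have hGt : 0 < surv F (t * r) :=
          hGr.trans_le (surv_anti (mul_le_of_le_one_left hr.le ht1.le))
        have h2 : Gam α (t * y) ≤ surv F (t * r) := by
          refine Gam_le_of_GamInv_le hα hGt (surv_le_one _) (le_of_mul_le_mul_left ?_ hr)
          have := GamInv_surv_le hα hF0 hF hGr (mul_nonneg ht0.le hr.le)
            (mul_le_of_le_one_left hr.le ht1.le)
          linarith
        have h3 := hmax (t * r) (mul_nonneg ht0.le hr.le)
        rw [hΓy] at h1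
        have h4 : t * (1 + y * (1 - t) / (1 + (1 - α) * y)) ≤ 1 := by
          refine le_of_mul_le_mul_left ?_ (mul_pos hr hGr)
          calc r * surv F r * (t * (1 + y * (1 - t) / (1 + (1 - α) * y)))
              = t * r * (surv F r - surv F r / (1 + (1 - α) * y) * (t * y - y)) := by ring
            _ ≤ t * r * surv F (t * r) := by
              have := h1.trans h2
              gcongr
            _ ≤ r * surv F r := h3
            _ = r * surv F r * 1 := by ring
        have h5 : (1 - t) * (t * y / (1 + (1 - α) * y)) ≤ (1 - t) * 1 := by
          have : t * (1 + y * (1 - t) / (1 + (1 - α) * y)) =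
            t + (1 - t) * (t * y / (1 + (1 - α) * y)) := by ring
          linarith
        have h6 := le_of_mul_le_mul_left h5 (sub_pos.2 ht1)
        rwa [div_le_one hD] at h6
      have hlim : α * y ≤ 1 := by
        by_contra! hlt
        have hy1 : 0 < y := by
          by_contra! h
          have : α * y ≤ 0 := mul_nonpos_of_nonneg_of_nonpos hα0 h
          linarith
        have h1 : (1 + (1 - α) * y) / y < 1 := by
          rw [div_lt_one hy1]
          linarith
        obtain ⟨t, ht1, ht2⟩ := exists_between h1
        have ht0 : 0 < t := (div_pos hD hy1).trans ht1
        rw [div_lt_iff₀ hy1] at ht1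
        exact absurd (key t ht0 ht2) (not_le.2 ht1)
      rw [le_div_iff₀ (by positivity)]
      calc r * (α * GamInv α q) = α * (r * GamInv α q) := by ring
        _ ≤ α * (w * y) := by gcongr
        _ = w * (α * y) := by ring
        _ ≤ w := mul_le_of_le_one_right hw.le hlim

/-- This is the domination of normalized survival functions. It needs no optimality of `r`, only
convexity and the values of `F̄` at `0` and `w`. -/
theorem worstSurvival_mul_surv_le [IsProbabilityMeasure F] (hα : α ≤ 1)
    (hw : 0 < w) (hF0 : F (Iio 0) = 0) (hF : IsStronglyRegular α F) (hq0 : 0 < q)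
    (hq1 : q < 1) (hq : surv F w = q) (hr : 0 < r) (hGr : 0 < surv F r) {p : ℝ} (hp : 0 ≤ p) :
    worstSurvival α r w q p * surv F r ≤ surv F p * worstSurvival α r w q r := by
  have hb := GamInv_pos hα hq0 hq1
  rcases lt_or_ge r w with hrw | hwr
  · rw [worstSurvival_of_lt hrw, worstSurvival_of_lt hrw]
    simp only [paretoSurvival, le_refl, if_true, mul_one]
    split_ifs with h1 h2
    · rw [one_mul]
      exact surv_anti h1
    · rw [mul_comm]
      exact mul_paretoGam_le_surv hα hF0 hF hq0 hq hr.le hrw (not_le.1 h1).le h2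
    · rw [zero_mul]
      exact surv_nonneg p
  · rw [worstSurvival_of_le hwr, worstSurvival_of_le hwr]
    simp only [paretoSurvival, hr.not_ge, if_false, le_refl, if_true, sub_zero]
    have hx0 : 0 ≤ GamInv α q * (r / w) := by positivity
    split_ifs with h1 h2
    · rw [le_antisymm h1 hp, surv_zero hF0, one_mul, one_mul]
      refine (Gam_le_of_le hα hx0 ?_).trans' (Gam_GamInv hα hGr).ge
      have := GamInv_surv_le hα hF0 hF hGr hw.le hwr
      rw [hq] at this
      rw [mul_div_assoc', div_le_iff₀ hw]
      linarith
    · have hGp : 0 < surv F p := hGr.trans_le (surv_anti h2)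
      have hxy : GamInv α q * (r / w) ≤ GamInv α (surv F r) := by
        have := GamInv_surv_le hα hF0 hF hGr hw.le hwr
        rw [hq] at this
        rw [mul_div_assoc', div_le_iff₀ hw]
        linarith
      -- With `t = p / r`, the ratio `Γ_α(t x) / Γ_α(x)` grows when `x` is raised from the family's
      -- argument at `r` to that of `F`.
      have h3 := Gam_mul_Gam_le hα (div_nonneg hp hr.le) ((div_le_one hr).2 h2) hx0 hxy
      rw [Gam_GamInv hα hGr] at h3
      have h4 : p / r * (GamInv α q * (r / w)) = GamInv α q * (p / w) := by
        field_simp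
      rw [h4] at h3
      refine h3.trans (mul_le_mul_of_nonneg_right ?_ (Gam_pos hα hx0).le)
      refine Gam_le_of_GamInv_le hα hGp (surv_le_one p) ?_
      have := GamInv_surv_le hα hF0 hF hGr hp h2
      rw [div_mul_eq_mul_div, le_div_iff₀ hr]
      linarith
    · rw [zero_mul]
      exact mul_nonneg (surv_nonneg p) (Gam_pos hα hx0).le

end

/-! ### Domination of the performance ratios -/

theorem worstSurvival_self_pos {α r w q : ℝ} (hα : α ≤ 1) (hw : 0 < w) (hq0 : 0 < q)
    (hq1 : q < 1) : 0 < worstSurvival α r w q r := by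
  have hb := GamInv_pos hα hq0 hq1
  rcases lt_or_ge r w with hrw | hwr
  · simp [worstSurvival_of_lt hrw, paretoSurvival]
  · have hr := hw.trans_le hwr
    simp only [worstSurvival_of_le hwr, paretoSurvival, hr.not_ge, if_false, le_refl, if_true]
    exact Gam_pos hα (paretoArg_nonneg hb hw hr.le)

/-- Every law of the class is dominated, for every mechanism, by the candidate worst case whose
parameter is an optimal price of the law. -/
theorem exists_worstLaw_ratio_le {α w q : ℝ} (hα0 : 0 ≤ α) (hα : α ≤ 1) (hw : 0 < w)
    (hq0 : 0 < q) (hq1 : q < 1) {F : Measure ℝ} (hF : F ∈ regularClass α w q) :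
    ∃ r ∈ priceRange α w q, ∀ Ψ : Measure ℝ, ratio Ψ (worstLaw α r w q) ≤ ratio Ψ F := by
  obtain ⟨⟨hprob, hF0⟩, -, hE, hsurv, hreg⟩ := hF
  have hq : surv F w = q := by
    rw [surv, hsurv, ENNReal.toReal_ofReal hq0.le]
  obtain ⟨r, hr0, hmax⟩ := exists_maximal_revenue hE hw (hq ▸ hq0 : 0 < surv F w)
  have hrev : 0 < r * surv F r := by
    refine lt_of_lt_of_le ?_ (hmax w hw.le)
    rw [hq]
    positivity
  have hr : 0 < r := pos_of_mul_pos_left hrev (surv_nonneg r)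
  have hGr : 0 < surv F r := pos_of_mul_pos_right hrev hr0
  have hrJ := maximal_price_mem_priceRange hα0 hα hw hF0 hreg hq0 hq1 hq hr hGr hmax
  refine ⟨r, hrJ, fun Ψ => ?_⟩
  have hoptF : opt F = ENNReal.ofReal (r * surv F r) := by
    refine le_antisymm (iSup₂_le fun v hv => ?_) (le_iSup₂_of_le r hr0 ?_)
    · rw [← ofReal_surv, ← ENNReal.ofReal_mul hv]
      exact ENNReal.ofReal_le_ofReal (hmax v hv)
    · rw [← ofReal_surv, ← ENNReal.ofReal_mul hr0]
  have hSr := worstSurvival_self_pos (r := r) hα hw hq0 hq1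
  have hoptW : opt (worstLaw α r w q) = ENNReal.ofReal (r * worstSurvival α r w q r) := by
    rw [← (isOptimalPrice_worstLaw hα0 hα hw hq0 hq1 hrJ).2,
      survival_worstLaw hα hq0 hq1 hw, ← ENNReal.ofReal_mul hr0]
  have hW0 : 0 < r * worstSurvival α r w q r := mul_pos hr hSr
  unfold ratio revenue
  rw [hoptF, hoptW, div_eq_mul_inv, div_eq_mul_inv,
    ← lintegral_mul_const' _ _ (ENNReal.inv_ne_top.2 (ENNReal.ofReal_pos.2 hW0).ne'),
    ← lintegral_mul_const' _ _ (ENNReal.inv_ne_top.2 (ENNReal.ofReal_pos.2 hrev).ne')]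
  refine lintegral_mono fun p => ?_
  -- Non-positive prices contribute nothing, since `ENNReal.ofReal` sends them to `0`; no assumption
  -- on `Ψ` is needed.
  rcases le_total p 0 with hp | hp
  · simp [ENNReal.ofReal_of_nonpos hp]
  · simp only [← div_eq_mul_inv]
    rw [survival_worstLaw hα hq0 hq1 hw, ← ofReal_surv, ← ENNReal.ofReal_mul hp,
      ← ENNReal.ofReal_mul hp, ← ENNReal.ofReal_div_of_pos hW0, ← ENNReal.ofReal_div_of_pos hrev]
    refine ENNReal.ofReal_le_ofReal ?_
    rw [div_le_div_iff₀ hW0 hrev]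
    have h := worstSurvival_mul_surv_le hα hw hF0 hreg hq0 hq1 hq hr hGr hp
    have h2 := mul_le_mul_of_nonneg_left h (mul_nonneg hp hr0)
    linarith

end SinglePointPricing

end

theorem theorem1 (α : ℝ) (hα0 : 0 ≤ α) (hα1 : α ≤ 1) (w : ℝ) (hw : 0 < w)
    (q : ℝ) (hq0 : 0 < q) (hq1 : q < 1) :
    (∀ r ∈ SinglePointPricing.priceRange α w q,
      SinglePointPricing.worstLaw α r w q ∈ SinglePointPricing.regularClass α w q ∧
      SinglePointPricing.IsOptimalPrice (SinglePointPricing.worstLaw α r w q) r) ∧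
    ∀ P' : Set (MeasureTheory.Measure ℝ), P' ⊆ SinglePointPricing.mechanisms →
      SinglePointPricing.maximinRatio P' (SinglePointPricing.regularClass α w q) =
        SinglePointPricing.maximinRatio P' (SinglePointPricing.worstFamily α w q) := by
  have hmem : ∀ r ∈ SinglePointPricing.priceRange α w q,
      SinglePointPricing.worstLaw α r w q ∈ SinglePointPricing.regularClass α w q := fun r hr =>
    SinglePointPricing.worstLaw_mem_regularClass hα1 hw hq0 hq1
      (SinglePointPricing.priceRange_pos hα1 hw hq0 hq1 hr)
  refine ⟨fun r hr => ⟨hmem r hr,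
    SinglePointPricing.isOptimalPrice_worstLaw hα0 hα1 hw hq0 hq1 hr⟩, fun P' _ => ?_⟩
  -- The two infima are equal for each fixed mechanism, by inclusion in one direction and domination
  -- in the other.
  refine iSup_congr fun Ψ => iSup_congr fun _ =>
    le_antisymm (le_iInf₂ ?_) (le_iInf₂ fun F hF => ?_)
  · rintro _ ⟨r, hr, rfl⟩
    exact iInf₂_le _ (hmem r hr)
  · obtain ⟨r, hr, hle⟩ :=
      SinglePointPricing.exists_worstLaw_ratio_le hα0 hα1 hw hq0 hq1 hF
    exact (iInf₂_le _ (Set.mem_image_of_mem _ hr)).trans (hle Ψ)
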